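/- A map $f:X\to Y$ of topological spaces is $F_\sigma$-measurable if the preimage of every open set is a countable union of closed sets, Darboux if it maps connected sets to connected sets, and Baire-one if it is the pointwise limit of a sequence of continuous maps $X\to Y$. There exist a connected subset $Y\subseteq\mathbb R^2$ and an $F_\sigma$-measurable Darboux map $f:\mathbb R\to Y$ that is not Baire-one. More precisely, let $(r_n)_{n\ge 1}$ be any enumeration of the rationals, i.e. $\mathbb Q=\{r_n:n\ge 1\}$ (repetitions are allowed). Put $\varphi_n(x)=\sin\frac1{x-r_n}$ for $x\ne r_n$ and $\varphi_n(r_n)=0$, let $g(x)=\sum_{n=1}^\infty 2^{-n}\varphi_n(x)$ for $x\in\mathbb R$ (the series converges for every $x$), let $Y=\{(x,y)\in\mathbb R^2: y=g(x)\}$ be the graph of $g$, and let $f:\mathbb R\to Y$, $f(x)=(x,g(x))$. Then $Y$ is connected, $f$ is $F_\sigma$-measurable and Darboux, and $f$ is not Baire-one. Moreover, $Y$ is punctiform (it contains no compact connected set with more than one point), and every continuous map $\mathbb R\to Y$ is constant. -/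

import Mathlib

open Filter Topology

namespace GraphExample

/-- An `F_σ`-set: a countable union of closed sets. -/
def IsFSigma {X : Type*} [TopologicalSpace X] (s : Set X) : Prop :=
  ∃ F : ℕ → Set X, (∀ n, IsClosed (F n)) ∧ s = ⋃ n, F n

/-- `F_σ`-measurability: preimages of open sets are `F_σ`-sets. -/
def FSigmaMeasurable {X Y : Type*} [TopologicalSpace X] [TopologicalSpace Y]
    (f : X → Y) : Prop :=
  ∀ V : Set Y, IsOpen V → IsFSigma (f ⁻¹' V)

/-- Darboux mappings: images of connected sets are connected. -/
def IsDarboux {X Y : Type*} [TopologicalSpace X] [TopologicalSpace Y] (f : X → Y) : Prop :=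
  ∀ C : Set X, IsConnected C → IsConnected (f '' C)

/-- Baire-one mappings: pointwise limits of sequences of continuous mappings `X → Y`. -/
def IsBaireOne {X Y : Type*} [TopologicalSpace X] [TopologicalSpace Y] (f : X → Y) : Prop :=
  ∃ F : ℕ → X → Y, (∀ n, Continuous (F n)) ∧ ∀ x, Tendsto (fun n => F n x) atTop (𝓝 (f x))

/-- A subset of a Hausdorff space is punctiform if it contains no continuum (compact connected
set) with more than one point. -/
def IsPunctiform {X : Type*} [TopologicalSpace X] [T2Space X] (Y : Set X) : Prop :=
  ∀ K : Set X, K ⊆ Y → IsCompact K → IsConnected K → K.Subsingleton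

/-- The function `x ↦ sin (1 / (x - a))`, with value `0` at `a`. -/
noncomputable def phi (a x : ℝ) : ℝ :=
  if x = a then 0 else Real.sin (1 / (x - a))

/-- `g(x) = ∑_{n ≥ 1} 2⁻ⁿ φ_n(x)`; here the `n`-th rational, `n ≥ 1`, is `r (n - 1)`. -/
noncomputable def g (r : ℕ → ℚ) (x : ℝ) : ℝ :=
  ∑' n : ℕ, 1 / 2 ^ (n + 1) * phi (r n) x

/-- The graph of a real function, as a subset of the plane. -/
def graph (u : ℝ → ℝ) : Set (ℝ × ℝ) := {p | p.2 = u p.1}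

/-- The graph map `x ↦ (x, u x)`, as a map from the line into the graph. -/
def graphMap (u : ℝ → ℝ) (x : ℝ) : graph u := ⟨(x, u x), rfl⟩

end GraphExample

namespace GraphExample

/-! At any `a`, `g r` is a function continuous at `a` plus `weight r a` times `phi a` (`g_eq`). Off
the rationals the weight vanishes, so the graph map has only countably many discontinuities and is
`F_σ`-measurable. Zeros of the sine make its value at every point a cluster value from both sides;
with a Baire category argument this gives Darboux.

At a rational the weight is positive, so peaks of the sine produce limits of graph points lying off
the graph. Hence no compact set in the graph projects onto a nondegenerate interval, and the graph
is punctiform. Continuous maps from the line into it, and their pointwise limits, are therefore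
constant, whereas the graph map is injective. -/

/-! ### `F_σ`-sets and a Darboux criterion -/

theorem IsFSigma.of_isOpen {X : Type*} [PseudoEMetricSpace X] {s : Set X} (hs : IsOpen s) :
    IsFSigma s := by
  obtain ⟨F, hF, -, hU, -⟩ := hs.exists_iUnion_isClosed
  exact ⟨F, hF, hU.symm⟩

theorem IsFSigma.union {X : Type*} [TopologicalSpace X] {s t : Set X} (hs : IsFSigma s)
    (ht : IsFSigma t) : IsFSigma (s ∪ t) := by
  obtain ⟨F, hF, rfl⟩ := hs
  obtain ⟨G, hG, rfl⟩ := ht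
  exact ⟨fun n => F n ∪ G n, fun n => (hF n).union (hG n), Set.iUnion_union_distrib F G |>.symm⟩

theorem IsFSigma.of_countable {X : Type*} [TopologicalSpace X] [T1Space X] {s : Set X}
    (hs : s.Countable) : IsFSigma s := by
  rcases s.eq_empty_or_nonempty with rfl | hne
  · exact ⟨fun _ => ∅, fun _ => isClosed_empty, by simp⟩
  · obtain ⟨e, rfl⟩ := hs.exists_eq_range hne
    exact ⟨fun n => {e n}, fun n => isClosed_singleton, by simp⟩

/-- A map which is continuous off a countable set is `F_σ`-measurable. -/
theorem fSigmaMeasurable_of_countable {X Y : Type*} [MetricSpace X] [TopologicalSpace Y]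
    {f : X → Y} {D : Set X} (hD : D.Countable) (hf : ∀ x ∉ D, ContinuousAt f x) :
    FSigmaMeasurable f := by
  intro V hV
  have h : f ⁻¹' V = interior (f ⁻¹' V) ∪ (f ⁻¹' V ∩ D) := by
    apply Set.Subset.antisymm
    · intro x hx
      by_cases hxD : x ∈ D
      · exact Or.inr ⟨hx, hxD⟩
      · exact Or.inl (mem_interior_iff_mem_nhds.2 (hf x hxD (hV.mem_nhds hx)))
    · exact Set.union_subset interior_subset Set.inter_subset_left
  rw [h]
  exact (IsFSigma.of_isOpen isOpen_interior).union
    (IsFSigma.of_countable (hD.mono Set.inter_subset_right))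

/-- A nonempty countable closed subset of a complete metric space has an isolated point. -/
theorem exists_isolated_of_countable {X : Type*} [MetricSpace X] [CompleteSpace X] {F : Set X}
    (hF : IsClosed F) (hc : F.Countable) (hne : F.Nonempty) :
    ∃ x ∈ F, ∃ U, IsOpen U ∧ x ∈ U ∧ U ∩ F ⊆ {x} := by
  have := hF.completeSpace_coe
  have := hc.to_subtype
  have := hne.to_subtype
  -- Baire category: `F` is a countable union of closed singletons, so one of them has interior.
  obtain ⟨x, y, hy⟩ := nonempty_interior_of_iUnion_of_closed
    (f := fun x : F => ({x} : Set F)) (fun x => isClosed_singleton)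
    (Set.eq_univ_of_forall fun x => Set.mem_iUnion.2 ⟨x, rfl⟩)
  obtain ⟨V, hV, hVo, hyV⟩ := mem_interior.1 hy
  obtain ⟨U, hU, rfl⟩ := isOpen_induced_iff.1 hVo
  obtain rfl : y = x := hV hyV
  refine ⟨y, y.2, U, hU, hyV, ?_⟩
  rintro z ⟨hzU, hzF⟩
  exact congrArg Subtype.val (hV (show (⟨z, hzF⟩ : F) ∈ Subtype.val ⁻¹' U from hzU))

/-- A separation of the image splits the interval into two pieces whose closures meet only at
discontinuities. This meeting set is closed, countable and nonempty, so it has an isolated point;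
the one-sided cluster values produce another of its points nearby. -/
theorem isPreconnected_image_Icc {Y : Type*} [TopologicalSpace Y] {f : ℝ → Y} {D : Set ℝ}
    (hD : D.Countable) (hf : ∀ x ∉ D, ContinuousAt f x)
    (hr : ∀ x, MapClusterPt (f x) (𝓝[>] x) f) (hl : ∀ x, MapClusterPt (f x) (𝓝[<] x) f)
    (a b : ℝ) : IsPreconnected (f '' Set.Icc a b) := by
  rintro U V hU hV hUV ⟨_, ⟨u, hu, rfl⟩, huU⟩ ⟨_, ⟨v, hv, rfl⟩, hvV⟩
  by_contra hcon
  set I := Set.Icc a b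
  have hdisj : ∀ x ∈ I, f x ∈ U → f x ∈ V → False := fun x hx h1 h2 =>
    hcon ⟨f x, ⟨x, hx, rfl⟩, h1, h2⟩
  have hcov : ∀ x ∈ I, f x ∈ U ∨ f x ∈ V := fun x hx => hUV ⟨x, hx, rfl⟩
  set S := I ∩ f ⁻¹' U
  set T := I ∩ f ⁻¹' V
  have hmeet : ∀ J : Set ℝ, IsPreconnected J → J ⊆ I → (J ∩ S).Nonempty → (J ∩ T).Nonempty →
      (J ∩ (closure S ∩ closure T)).Nonempty := by
    intro J hJ hJI hS hT
    refine isPreconnected_closed_iff.1 hJ _ _ isClosed_closure isClosed_closure ?_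
      (hS.mono (Set.inter_subset_inter_right _ subset_closure))
      (hT.mono (Set.inter_subset_inter_right _ subset_closure))
    intro x hx
    exact (hcov x (hJI hx)).imp (fun h => subset_closure ⟨hJI hx, h⟩)
      (fun h => subset_closure ⟨hJI hx, h⟩)
  have hSI : closure S ⊆ I := closure_minimal Set.inter_subset_left isClosed_Icc
  have hne : (closure S ∩ closure T).Nonempty :=
    (hmeet I isPreconnected_Icc subset_rfl ⟨u, hu, hu, huU⟩ ⟨v, hv, hv, hvV⟩).mono
      Set.inter_subset_right
  have hsub : closure S ∩ closure T ⊆ D := by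
    rintro x ⟨hxS, hxT⟩
    by_contra hxD
    rcases hcov x (hSI hxS) with h | h
    · obtain ⟨y, hy, hyT⟩ := mem_closure_iff_nhds.1 hxT _ (hf x hxD (hU.mem_nhds h))
      exact hdisj y hyT.1 hy hyT.2
    · obtain ⟨y, hy, hyS⟩ := mem_closure_iff_nhds.1 hxS _ (hf x hxD (hV.mem_nhds h))
      exact hdisj y hyS.1 hyS.2 hy
  obtain ⟨x, ⟨hxS, hxT⟩, W, hW, hxW, hWF⟩ := exists_isolated_of_countable
    (isClosed_closure.inter isClosed_closure) (hD.mono hsub) hne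
  have hxI := hSI hxS
  obtain ⟨δ, hδ, hball⟩ := Metric.isOpen_iff.1 hW x hxW
  -- `A` is the piece containing `x`, and `B` is the other one
  have key : ∀ A B : Set Y, IsOpen A → f x ∈ A → f x ∉ B → x ∈ closure (I ∩ f ⁻¹' B) →
      (∀ J : Set ℝ, IsPreconnected J → J ⊆ I → (J ∩ (I ∩ f ⁻¹' A)).Nonempty →
        (J ∩ (I ∩ f ⁻¹' B)).Nonempty → (J ∩ (closure S ∩ closure T)).Nonempty) → False := by
    intro A B hA hxA hxB hcl hm
    obtain ⟨y, ⟨hyI, hyB⟩, hyd⟩ := Metric.mem_closure_iff.1 hcl δ hδ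
    rw [Real.dist_eq, abs_lt] at hyd
    -- The segment from `z` to `y` meets both pieces but omits `x`, so it carries a second meeting
    -- point inside `W`.
    have hfin : ∀ z, f z ∈ A → (x < z ∧ z < y ∨ y < z ∧ z < x) → False := by
      intro z hzA hz
      have hzI : z ∈ I := by
        obtain ⟨h1, h2⟩ := hxI
        obtain ⟨h3, h4⟩ := hyI
        rcases hz with h | h <;> constructor <;> linarith
      obtain ⟨w, hw, hwF⟩ := hm (Set.uIcc z y) isPreconnected_uIcc
        (Set.ordConnected_Icc.uIcc_subset hzI hyI) ⟨z, Set.left_mem_uIcc, hzI, hzA⟩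
        ⟨y, Set.right_mem_uIcc, hyI, hyB⟩
      rcases hz with ⟨h1, h2⟩ | ⟨h1, h2⟩
      · rw [Set.uIcc_of_le h2.le] at hw
        have : w = x := hWF ⟨hball (by
          rw [Metric.mem_ball, Real.dist_eq, abs_lt]; constructor <;> linarith [hw.1, hw.2]), hwF⟩
        linarith [hw.1]
      · rw [Set.uIcc_of_ge h1.le] at hw
        have : w = x := hWF ⟨hball (by
          rw [Metric.mem_ball, Real.dist_eq, abs_lt]; constructor <;> linarith [hw.1, hw.2]), hwF⟩
        linarith [hw.2]
    rcases lt_trichotomy x y with h | h | h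
    · obtain ⟨z, hzA, hz⟩ := ((mapClusterPt_iff_frequently.1 (hr x) A (hA.mem_nhds hxA)).and_eventually
        (Ioo_mem_nhdsGT h)).exists
      exact hfin z hzA (Or.inl hz)
    · exact hxB (h ▸ hyB)
    · obtain ⟨z, hzA, hz⟩ := ((mapClusterPt_iff_frequently.1 (hl x) A (hA.mem_nhds hxA)).and_eventually
        (Ioo_mem_nhdsLT h)).exists
      exact hfin z hzA (Or.inr hz)
  rcases hcov x hxI with h | h
  · exact key U V hU h (hdisj x hxI h) hxT hmeet
  · exact key V U hV h (fun h' => hdisj x hxI h' h) hxS fun J h1 h2 h3 h4 => hmeet J h1 h2 h4 h3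

/-- A map on the line which is continuous off a countable set and whose value at each point is a
cluster value from both sides is Darboux. -/
theorem isDarboux_of_countable {Y : Type*} [TopologicalSpace Y] {f : ℝ → Y} {D : Set ℝ}
    (hD : D.Countable) (hf : ∀ x ∉ D, ContinuousAt f x)
    (hr : ∀ x, MapClusterPt (f x) (𝓝[>] x) f) (hl : ∀ x, MapClusterPt (f x) (𝓝[<] x) f) :
    IsDarboux f := by
  intro C hC
  refine ⟨hC.nonempty.image f, isPreconnected_of_forall_pair ?_⟩
  rintro _ ⟨x, hx, rfl⟩ _ ⟨y, hy, rfl⟩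
  exact ⟨f '' Set.uIcc x y, Set.image_mono (hC.isPreconnected.ordConnected.uIcc_subset hx hy),
    ⟨x, Set.left_mem_uIcc, rfl⟩, ⟨y, Set.right_mem_uIcc, rfl⟩,
    isPreconnected_image_Icc hD hf hr hl _ _⟩

/-! ### The series and its local behaviour -/

theorem abs_phi_le_one (a x : ℝ) : |phi a x| ≤ 1 := by
  unfold phi
  split_ifs
  · simp
  · exact Real.abs_sin_le_one _

theorem phi_self (a : ℝ) : phi a a = 0 := if_pos rfl

theorem phi_add (a : ℝ) {t : ℝ} (ht : t ≠ 0) : phi a (a + t⁻¹) = Real.sin t := by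
  simp [phi, ht]

theorem continuousAt_phi {a x : ℝ} (h : x ≠ a) : ContinuousAt (phi a) x := by
  have h1 : ContinuousAt (fun y => Real.sin (1 / (y - a))) x :=
    Real.continuous_sin.continuousAt.comp
      (continuousAt_const.div (by fun_prop) (sub_ne_zero.2 h))
  refine h1.congr ?_
  filter_upwards [isOpen_ne.mem_nhds h] with y hy
  exact (if_neg hy).symm

theorem summable_weights : Summable fun n : ℕ => (1 : ℝ) / 2 ^ (n + 1) := by
  have := (summable_geometric_two).mul_left (1 / 2 : ℝ)
  refine this.congr fun n => ?_
  rw [pow_succ, one_div_pow]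
  field_simp

theorem norm_weight_mul_le (n : ℕ) {y : ℝ} (hy : |y| ≤ 1) :
    ‖1 / 2 ^ (n + 1) * y‖ ≤ (1 : ℝ) / 2 ^ (n + 1) := by
  rw [norm_mul, Real.norm_of_nonneg (by positivity)]
  exact mul_le_of_le_one_right (by positivity) hy

theorem summable_phi (r : ℕ → ℚ) (x : ℝ) :
    Summable fun n : ℕ => 1 / 2 ^ (n + 1) * phi (r n) x :=
  summable_weights.of_norm_bounded fun n => norm_weight_mul_le n (abs_phi_le_one _ _)

/-- The total weight of the terms of `g r` that are singular at `a`. -/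
noncomputable def weight (r : ℕ → ℚ) (a : ℝ) : ℝ :=
  ∑' n : ℕ, 1 / 2 ^ (n + 1) * (if (r n : ℝ) = a then 1 else 0)

/-- The sum of the terms of `g r` that are continuous at `a`. -/
noncomputable def regularPart (r : ℕ → ℚ) (a x : ℝ) : ℝ :=
  ∑' n : ℕ, 1 / 2 ^ (n + 1) * (if (r n : ℝ) = a then 0 else phi (r n) x)

theorem abs_regular_term_le_one (r : ℕ → ℚ) (a x : ℝ) (n : ℕ) :
    |if (r n : ℝ) = a then 0 else phi (r n) x| ≤ 1 := by
  split_ifs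
  · simp
  · exact abs_phi_le_one _ _

theorem summable_weight (r : ℕ → ℚ) (a : ℝ) :
    Summable fun n : ℕ => (1 : ℝ) / 2 ^ (n + 1) * (if (r n : ℝ) = a then 1 else 0) :=
  summable_weights.of_norm_bounded fun n => norm_weight_mul_le n (by split_ifs <;> simp)

/-- Since `r` may repeat values, all terms singular at `a` are collected into a single coefficient.
-/
theorem g_eq (r : ℕ → ℚ) (a x : ℝ) : g r x = regularPart r a x + weight r a * phi a x := by
  have h1 : Summable fun n : ℕ => 1 / 2 ^ (n + 1) * (if (r n : ℝ) = a then 0 else phi (r n) x) :=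
    summable_weights.of_norm_bounded fun n =>
      norm_weight_mul_le n (abs_regular_term_le_one r a x n)
  rw [g, regularPart, weight, ← tsum_mul_right, ← h1.tsum_add ((summable_weight r a).mul_right _)]
  refine tsum_congr fun n => ?_
  split_ifs with h
  · rw [h]; ring
  · ring

theorem continuousAt_regularPart (r : ℕ → ℚ) (a : ℝ) : ContinuousAt (regularPart r a) a := by
  refine tendsto_tsum_of_dominated_convergence summable_weights (fun n => ?_)
    (Eventually.of_forall fun x n => norm_weight_mul_le n (abs_regular_term_le_one r a x n))
  refine Tendsto.const_mul _ ?_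
  split_ifs with h
  · exact tendsto_const_nhds
  · exact continuousAt_phi (Ne.symm h)

theorem weight_pos {r : ℕ → ℚ} (hr : Function.Surjective r) (q : ℚ) : 0 < weight r q := by
  obtain ⟨n, rfl⟩ := hr q
  refine (summable_weight r (r n)).tsum_pos (fun m => ?_) n (by simp)
  split_ifs <;> simp

theorem continuousAt_g (r : ℕ → ℚ) {a : ℝ} (ha : a ∉ Set.range ((↑) : ℚ → ℝ)) :
    ContinuousAt (g r) a := by
  have hw : weight r a = 0 := by
    have : ∀ n, (r n : ℝ) ≠ a := fun n h => ha ⟨r n, h⟩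
    simp [weight, this]
  have : g r = regularPart r a := funext fun x => by rw [g_eq r a, hw, zero_mul, add_zero]
  rw [this]
  exact continuousAt_regularPart r a

theorem continuousAt_graphMap {u : ℝ → ℝ} {a : ℝ} (h : ContinuousAt u a) :
    ContinuousAt (graphMap u) a :=
  tendsto_subtype_rng.2 (continuousAt_id.prodMk h)

/-- Approaching `a` along points where the oscillating term takes the value `c`. -/
theorem tendsto_g (r : ℕ → ℚ) (a : ℝ) {t : ℕ → ℝ} {c : ℝ}
    (ht : Tendsto (fun k => (t k)⁻¹) atTop (𝓝 0)) (h0 : ∀ k, t k ≠ 0)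
    (hc : ∀ k, Real.sin (t k) = c) :
    Tendsto (fun k => g r (a + (t k)⁻¹)) atTop (𝓝 (g r a + weight r a * c)) := by
  have hx : Tendsto (fun k => a + (t k)⁻¹) atTop (𝓝 a) := by
    simpa using ht.const_add a
  have h := ((continuousAt_regularPart r a).tendsto.comp hx).add_const (weight r a * c)
  have hga : g r a = regularPart r a a := by rw [g_eq r a, phi_self, mul_zero, add_zero]
  rw [hga]
  refine h.congr fun k => ?_
  rw [g_eq r a, phi_add a (h0 k), hc, Function.comp_apply]

-- The shift by one keeps these zeros of the sine nonzero, so they can be inverted.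
theorem tendsto_pi_mul_atTop : Tendsto (fun k : ℕ => Real.pi * ((k : ℝ) + 1)) atTop atTop :=
  (tendsto_natCast_atTop_atTop.atTop_add tendsto_const_nhds).const_mul_atTop Real.pi_pos

theorem sin_pi_mul (k : ℕ) : Real.sin (Real.pi * ((k : ℝ) + 1)) = 0 := by
  rw [mul_comm]
  exact_mod_cast Real.sin_nat_mul_pi (k + 1)

theorem mapClusterPt_graphMap (r : ℕ → ℚ) (a : ℝ) {s : Set ℝ} {t : ℕ → ℝ}
    (ht : Tendsto (fun k => (t k)⁻¹) atTop (𝓝 0)) (h0 : ∀ k, t k ≠ 0)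
    (hc : ∀ k, Real.sin (t k) = 0) (hs : ∀ k, a + (t k)⁻¹ ∈ s) :
    MapClusterPt (graphMap (g r) a) (𝓝[s] a) (graphMap (g r)) := by
  have hx : Tendsto (fun k => a + (t k)⁻¹) atTop (𝓝 a) := by
    simpa using ht.const_add a
  have hg := tendsto_g r a ht h0 hc
  rw [mul_zero, add_zero] at hg
  have hm : Tendsto (fun k => graphMap (g r) (a + (t k)⁻¹)) atTop (𝓝 (graphMap (g r) a)) :=
    tendsto_subtype_rng.2 (hx.prodMk_nhds hg)
  exact MapClusterPt.of_comp
    (tendsto_nhdsWithin_iff.2 ⟨hx, Eventually.of_forall hs⟩) hm.mapClusterPt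

theorem mapClusterPt_graphMap_right (r : ℕ → ℚ) (a : ℝ) :
    MapClusterPt (graphMap (g r) a) (𝓝[>] a) (graphMap (g r)) := by
  have hp : ∀ k : ℕ, 0 < Real.pi * ((k : ℝ) + 1) := fun k => by positivity
  exact mapClusterPt_graphMap r a (tendsto_inv_atTop_zero.comp tendsto_pi_mul_atTop)
    (fun k => (hp k).ne') sin_pi_mul fun k => lt_add_of_pos_right a (inv_pos.2 (hp k))

theorem mapClusterPt_graphMap_left (r : ℕ → ℚ) (a : ℝ) :
    MapClusterPt (graphMap (g r) a) (𝓝[<] a) (graphMap (g r)) := by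
  have hn : ∀ k : ℕ, -(Real.pi * ((k : ℝ) + 1)) < 0 := fun k => neg_lt_zero.2 (by positivity)
  exact mapClusterPt_graphMap r a
    (tendsto_inv_atBot_zero.comp (tendsto_neg_atTop_atBot.comp tendsto_pi_mul_atTop))
    (fun k => (hn k).ne) (fun k => by rw [Function.comp_apply, Real.sin_neg, sin_pi_mul, neg_zero])
    fun k => add_lt_of_neg_right a (inv_lt_zero.2 (hn k))

/-! ### Properties of the graph -/

theorem fSigmaMeasurable_graphMap (r : ℕ → ℚ) : FSigmaMeasurable (graphMap (g r)) :=
  fSigmaMeasurable_of_countable (Set.countable_range _)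
    fun _ hx => continuousAt_graphMap (continuousAt_g r hx)

theorem isDarboux_graphMap (r : ℕ → ℚ) : IsDarboux (graphMap (g r)) :=
  isDarboux_of_countable (Set.countable_range _)
    (fun _ hx => continuousAt_graphMap (continuousAt_g r hx))
    (mapClusterPt_graphMap_right r) (mapClusterPt_graphMap_left r)

theorem isConnected_graph (r : ℕ → ℚ) : IsConnected (graph (g r)) := by
  have h := (isDarboux_graphMap r Set.univ isConnected_univ).image Subtype.val
    continuous_subtype_val.continuousOn
  convert h
  ext ⟨x, y⟩
  constructor
  · intro hp
    exact ⟨⟨(x, y), hp⟩, ⟨x, trivial, Subtype.ext (Prod.ext rfl hp.symm)⟩, rfl⟩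
  · rintro ⟨p, -, hp⟩
    exact hp ▸ p.2

theorem isPunctiform_graph {r : ℕ → ℚ} (hr : Function.Surjective r) :
    IsPunctiform (graph (g r)) := by
  intro K hK hKc hKconn p hp p' hp'
  by_contra hne
  have hfst : p.1 ≠ p'.1 := fun h =>
    hne (Prod.ext h ((hK hp).trans ((congrArg (g r) h).trans (hK hp').symm)))
  have hproj : (Prod.fst '' K).OrdConnected :=
    (hKconn.isPreconnected.image _ continuous_fst.continuousOn).ordConnected
  -- As `K` lies in a graph, its projection determines it.
  have hmem : ∀ x ∈ Set.uIcc p.1 p'.1, (x, g r x) ∈ K := by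
    intro x hx
    obtain ⟨z, hz, rfl⟩ := hproj.uIcc_subset ⟨p, hp, rfl⟩ ⟨p', hp', rfl⟩ hx
    have : (z.1, g r z.1) = z := Prod.ext rfl (hK hz).symm
    rwa [this]
  obtain ⟨q, hq1, hq2⟩ := exists_rat_btwn (inf_lt_sup.2 hfst)
  -- At these peaks the sine is 1, so the limit sits `weight r q` above the graph at `q`.
  let t : ℕ → ℝ := fun k => Real.pi / 2 + k * (2 * Real.pi)
  have ht0 : ∀ k, t k ≠ 0 := fun k => by
    have : 0 < t k := by positivity
    exact this.ne'
  have htt : Tendsto t atTop atTop := tendsto_atTop_add_const_left _ _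
    (tendsto_natCast_atTop_atTop.atTop_mul_const (by positivity))
  have hti : Tendsto (fun k => (t k)⁻¹) atTop (𝓝 0) := tendsto_inv_atTop_zero.comp htt
  have hts : ∀ k, Real.sin (t k) = 1 := fun k => by
    rw [Real.sin_add_nat_mul_two_pi, Real.sin_pi_div_two]
  have hx : Tendsto (fun k => (q : ℝ) + (t k)⁻¹) atTop (𝓝 (q : ℝ)) := by
    simpa using hti.const_add (q : ℝ)
  have hlim : ((q : ℝ), g r q + weight r q * 1) ∈ K := by
    refine hKc.isClosed.mem_of_tendsto (hx.prodMk_nhds (tendsto_g r q hti ht0 hts)) ?_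
    filter_upwards [hx (Icc_mem_nhds hq1 hq2)] with k hk
    exact hmem _ hk
  have h : g r q + weight r q * 1 = g r q := hK hlim
  linarith [weight_pos hr q]

/-- Continuous maps from the line into a punctiform set are constant. -/
theorem IsPunctiform.eq_of_continuous {X : Type*} [TopologicalSpace X] [T2Space X] {Y : Set X}
    (hY : IsPunctiform Y) {h : ℝ → Y} (hh : Continuous h) (s t : ℝ) : h s = h t := by
  have hc : Continuous fun x => (h x : X) := continuous_subtype_val.comp hh
  refine Subtype.ext (hY ((fun x => (h x : X)) '' Set.uIcc s t) ?_ (isCompact_uIcc.image hc)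
    ⟨⟨_, s, Set.left_mem_uIcc, rfl⟩, isPreconnected_uIcc.image _ hc.continuousOn⟩
    ⟨s, Set.left_mem_uIcc, rfl⟩ ⟨t, Set.right_mem_uIcc, rfl⟩)
  rintro _ ⟨x, -, rfl⟩
  exact (h x).2

theorem IsPunctiform.eq_of_isBaireOne {X : Type*} [TopologicalSpace X] [T2Space X] {Y : Set X}
    (hY : IsPunctiform Y) {f : ℝ → Y} (hf : IsBaireOne f) (s t : ℝ) : f s = f t := by
  obtain ⟨F, hF, hlim⟩ := hf
  exact tendsto_nhds_unique (hlim s)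
    ((hlim t).congr fun n => hY.eq_of_continuous (hF n) t s)

theorem not_isBaireOne_graphMap {r : ℕ → ℚ} (hr : Function.Surjective r) :
    ¬ IsBaireOne (graphMap (g r)) := fun h =>
  zero_ne_one (congrArg (fun p => p.1.1) ((isPunctiform_graph hr).eq_of_isBaireOne h 0 1))

end GraphExample

theorem mainTheorem7 :
    (∃ (Y : Set (ℝ × ℝ)) (f : ℝ → Y), IsConnected Y ∧
      GraphExample.FSigmaMeasurable f ∧ GraphExample.IsDarboux f ∧
      ¬ GraphExample.IsBaireOne f) ∧
    ∀ r : ℕ → ℚ, Function.Surjective r →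
      (∀ x : ℝ, Summable fun n : ℕ => 1 / 2 ^ (n + 1) * GraphExample.phi (r n) x) ∧
      IsConnected (GraphExample.graph (GraphExample.g r)) ∧
      GraphExample.FSigmaMeasurable (GraphExample.graphMap (GraphExample.g r)) ∧
      GraphExample.IsDarboux (GraphExample.graphMap (GraphExample.g r)) ∧
      ¬ GraphExample.IsBaireOne (GraphExample.graphMap (GraphExample.g r)) ∧
      GraphExample.IsPunctiform (GraphExample.graph (GraphExample.g r)) ∧
      ∀ h : ℝ → GraphExample.graph (GraphExample.g r), Continuous h → ∃ c, ∀ t, h t = c := by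
  constructor
  · obtain ⟨r, hr⟩ := exists_surjective_nat ℚ
    exact ⟨_, GraphExample.graphMap (GraphExample.g r), GraphExample.isConnected_graph r,
      GraphExample.fSigmaMeasurable_graphMap r, GraphExample.isDarboux_graphMap r,
      GraphExample.not_isBaireOne_graphMap hr⟩
  · intro r hr
    exact ⟨GraphExample.summable_phi r, GraphExample.isConnected_graph r,
      GraphExample.fSigmaMeasurable_graphMap r, GraphExample.isDarboux_graphMap r,
      GraphExample.not_isBaireOne_graphMap hr, GraphExample.isPunctiform_graph hr,
      fun h hh => ⟨h 0, fun t => (GraphExample.isPunctiform_graph hr).eq_of_continuous hh t 0⟩⟩
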